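/- Let $\mathbb{Z}_2$ be the ring of $2$-adic integers. A subgroup $G \leq \mathrm{GL}_2(\mathbb{Z}_2)$ is called minimal if it has finite index in $\mathrm{GL}_2(\mathbb{Z}_2)$, $\det(G) = \mathbb{Z}_2^\times$, and $\det(K) \neq \mathbb{Z}_2^\times$ for every proper closed subgroup $K \subsetneq G$. Theorem. Let $H \leq \mathrm{GL}_2(\mathbb{Z}_2)$ be any subgroup of finite index with $\det(H) = \mathbb{Z}_2^\times$. Then there is a minimal subgroup $M \leq H$ with $|H : M| < \infty$. -/

import Mathlib

/-- A subgroup `H` of `GL₂(ℤ₂)` is *minimal* if it has finite index, its determinant is all of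
`ℤ₂ˣ`, and no proper closed subgroup of `H` has determinant all of `ℤ₂ˣ`. -/
structure IsMinimalSubgroup (H : Subgroup (Matrix.GeneralLinearGroup (Fin 2) ℤ_[2])) : Prop where
  finiteIndex : H.FiniteIndex
  map_det : H.map Matrix.GeneralLinearGroup.det = ⊤
  map_det_ne_of_lt : ∀ K : Subgroup (Matrix.GeneralLinearGroup (Fin 2) ℤ_[2]),
    IsClosed (K : Set (Matrix.GeneralLinearGroup (Fin 2) ℤ_[2])) → K < H →
      K.map Matrix.GeneralLinearGroup.det ≠ ⊤

open scoped MatrixGroups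
open Matrix

namespace TwoAdic

/-! Take `M` to be the closure of the group generated by two elements `g`, `h` of `H` with
determinants -1 and 125, whose reductions mod 2 generate a group of exponent dividing 2.

Minimality is a Frattini argument. Each finite quotient of `M` is a 2-group on two generators, so
its index-2 subgroups come from sign characters fixed by their values at `g` and `h`. Since -1 and 5
form a basis of `(ZMod 8)ˣ`, each such character factors through the determinant mod 8. A closed
subgroup of full determinant lies in no such kernel, hence is everything (`closure_pair_le`,
`topologicalClosure_le_of_map_det`).

For finite index, `g` and `h` are put in general position (`exists_generic`), so that 1, `g`, `h`,
`gh` span the matrices over ℚ₂. Suitable powers of `g`, `h`, `gh` are close to scalars, so `M` times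
the scalars contains a congruence subgroup (`exists_red_eq_one_mem_withScalars`). Commutators remove
the scalars and give elementary matrices in `M`; the full determinant does the rest
(`finiteIndex_of_elementary`). -/

/-! ### Congruences modulo powers of 2 and the topology of GL₂(ℤ₂). -/

/-- Reduction of a matrix in `GL₂(ℤ₂)` modulo `2 ^ n`. -/
noncomputable def red (n : ℕ) : GL (Fin 2) ℤ_[2] →* GL (Fin 2) (ZMod (2 ^ n)) :=
  GeneralLinearGroup.map (PadicInt.toZModPow n)

theorem toZModPow_eq_iff (n : ℕ) (x y : ℤ_[2]) :
    PadicInt.toZModPow n x = PadicInt.toZModPow n y ↔ (2 : ℤ_[2]) ^ n ∣ x - y := by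
  rw [← sub_eq_zero, ← map_sub, ← RingHom.mem_ker, PadicInt.ker_toZModPow,
    Ideal.mem_span_singleton]
  norm_cast

theorem red_eq_iff_dvd (n : ℕ) (x y : GL (Fin 2) ℤ_[2]) :
    red n x = red n y ↔ ∀ i j, (2 : ℤ_[2]) ^ n ∣ x i j - y i j := by
  simp only [GeneralLinearGroup.ext_iff, red, GeneralLinearGroup.map_apply, toZModPow_eq_iff]

theorem red_eq_iff (n : ℕ) (x y : GL (Fin 2) ℤ_[2]) :
    red n x = red n y ↔ ∃ E : Matrix (Fin 2) (Fin 2) ℤ_[2],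
      (x : Matrix (Fin 2) (Fin 2) ℤ_[2]) = y + (2 : ℤ_[2]) ^ n • E := by
  rw [red_eq_iff_dvd]
  constructor
  · intro h
    choose E hE using h
    refine ⟨Matrix.of E, ?_⟩
    ext i j
    simp [← hE]
  · rintro ⟨E, hE⟩ i j
    exact ⟨E i j, by simp [hE]⟩

theorem red_eq_of_le {m n : ℕ} (hmn : m ≤ n) {x y : GL (Fin 2) ℤ_[2]} (h : red n x = red n y) :
    red m x = red m y := by
  rw [red_eq_iff_dvd] at *
  exact fun i j => (pow_dvd_pow _ hmn).trans (h i j)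

theorem pow_dvd_iff_norm (n : ℕ) (x : ℤ_[2]) :
    (2 : ℤ_[2]) ^ n ∣ x ↔ ‖x‖ ≤ (2 : ℝ) ^ (-n : ℤ) := by
  have := PadicInt.norm_le_pow_iff_mem_span_pow x n
  rw [Ideal.mem_span_singleton] at this
  exact_mod_cast this.symm

theorem isOpen_setOf_dvd (n : ℕ) : IsOpen {x : ℤ_[2] | (2 : ℤ_[2]) ^ n ∣ x} := by
  have : {x : ℤ_[2] | (2 : ℤ_[2]) ^ n ∣ x} = Metric.closedBall 0 ((2 : ℝ) ^ (-n : ℤ)) := by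
    ext x
    simp [pow_dvd_iff_norm]
  rw [this]
  exact IsUltrametricDist.isOpen_closedBall _ (by positivity)

theorem tendsto_zero_of_dvd {f : ℕ → ℤ_[2]} (h : ∀ n, (2 : ℤ_[2]) ^ n ∣ f n) :
    Filter.Tendsto f Filter.atTop (nhds 0) := by
  refine squeeze_zero_norm (a := fun n : ℕ => ((2 : ℝ)⁻¹) ^ n) (fun n => ?_) ?_
  · simpa using (pow_dvd_iff_norm n (f n)).1 (h n)
  · exact tendsto_pow_atTop_nhds_zero_of_lt_one (by norm_num) (by norm_num)

instance : CompactSpace (Matrix (Fin 2) (Fin 2) ℤ_[2]) :=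
  inferInstanceAs (CompactSpace (Fin 2 → Fin 2 → ℤ_[2]))

theorem continuous_coe : Continuous fun x : GL (Fin 2) ℤ_[2] =>
    (x : Matrix (Fin 2) (Fin 2) ℤ_[2]) := Units.continuous_val

theorem isOpen_setOf_red_eq (n : ℕ) (x : GL (Fin 2) ℤ_[2]) : IsOpen {y | red n y = red n x} := by
  simp only [red_eq_iff_dvd, Set.ofPred_forall]
  refine isOpen_iInter_of_finite fun i => isOpen_iInter_of_finite fun j => ?_
  exact (isOpen_setOf_dvd n).preimage ((continuous_coe.matrix_elem i j).sub continuous_const)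

theorem mem_of_forall_red {K : Set (GL (Fin 2) ℤ_[2])} (hK : IsClosed K) {x : GL (Fin 2) ℤ_[2]}
    (h : ∀ n, ∃ y ∈ K, red n y = red n x) : x ∈ K := by
  choose y hyK hy using h
  have hemb : Topology.IsClosedEmbedding fun x : GL (Fin 2) ℤ_[2] =>
      (x : Matrix (Fin 2) (Fin 2) ℤ_[2]) :=
    continuous_coe.isClosedEmbedding Units.val_injective
  have htend : Filter.Tendsto (fun n => (y n : Matrix (Fin 2) (Fin 2) ℤ_[2])) Filter.atTop
      (nhds (x : Matrix (Fin 2) (Fin 2) ℤ_[2])) := by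
    refine tendsto_pi_nhds.2 fun i => tendsto_pi_nhds.2 fun j => ?_
    have := tendsto_zero_of_dvd fun n => (red_eq_iff_dvd n _ _).1 (hy n) i j
    simpa using this.add_const (x i j)
  exact hK.mem_of_tendsto (hemb.tendsto_nhds_iff.2 htend) (Filter.Eventually.of_forall hyK)

theorem exists_red_eq_of_mem_closure {S : Set (GL (Fin 2) ℤ_[2])} {x : GL (Fin 2) ℤ_[2]}
    (hx : x ∈ closure S) (n : ℕ) : ∃ y ∈ S, red n y = red n x := by
  obtain ⟨y, hy, hyS⟩ := mem_closure_iff.1 hx _ (isOpen_setOf_red_eq n x) rfl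
  exact ⟨y, hyS, hy⟩

/-- A closed subgroup that approximates `1 + 2 ^ j E` to one further digit, for all `E` and all
`j ≥ j₀`, contains the principal congruence subgroup of level `2 ^ j₀`. -/
theorem mem_of_approx {N : Subgroup (GL (Fin 2) ℤ_[2])} (hN : IsClosed (N : Set (GL (Fin 2) ℤ_[2])))
    {j₀ : ℕ} (h : ∀ j ≥ j₀, ∀ E : Matrix (Fin 2) (Fin 2) ℤ_[2], ∃ x ∈ N,
      ∃ F : Matrix (Fin 2) (Fin 2) ℤ_[2], (x : Matrix (Fin 2) (Fin 2) ℤ_[2]) =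
        1 + (2 : ℤ_[2]) ^ j • E + (2 : ℤ_[2]) ^ (j + 1) • F)
    {x : GL (Fin 2) ℤ_[2]} (hx : red j₀ x = 1) : x ∈ N := by
  have key : ∀ n, ∃ y ∈ N, red (j₀ + n) y = red (j₀ + n) x := by
    intro n
    induction n with
    | zero => exact ⟨1, N.one_mem, by simp [hx]⟩
    | succ n ih =>
      obtain ⟨y, hyN, hy⟩ := ih
      obtain ⟨E, hE⟩ := (red_eq_iff _ _ _).1 hy.symm
      -- With x = y + 2^(j₀+n) E, a factor z ≈ 1 + 2^(j₀+n) y⁻¹E corrects the next digit of y.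
      obtain ⟨z, hzN, F, hF⟩ := h (j₀ + n) (by omega)
        ((y⁻¹ : GL (Fin 2) ℤ_[2]) * E : Matrix (Fin 2) (Fin 2) ℤ_[2])
      refine ⟨y * z, N.mul_mem hyN hzN, (red_eq_iff _ _ _).2 ⟨y * F, ?_⟩⟩
      rw [Units.val_mul, hF, hE]
      have : (y : Matrix (Fin 2) (Fin 2) ℤ_[2]) *
          ((y⁻¹ : GL (Fin 2) ℤ_[2]) : Matrix (Fin 2) (Fin 2) ℤ_[2]) = 1 := y.mul_inv
      simp only [mul_add, mul_one, mul_smul_comm, ← mul_assoc, this, one_mul]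
      rfl
  refine mem_of_forall_red hN fun n => ?_
  obtain ⟨y, hy, h⟩ := key n
  exact ⟨y, hy, red_eq_of_le (by omega) h⟩

theorem isUnit_iff_not_dvd (x : ℤ_[2]) : IsUnit x ↔ ¬ (2 : ℤ_[2]) ∣ x := by
  rw [PadicInt.isUnit_iff, ← not_iff_not, not_not]
  have h := PadicInt.norm_lt_one_iff_dvd (p := 2) x
  rw [Nat.cast_ofNat] at h
  rw [← h]
  exact ⟨fun h' => lt_of_le_of_ne (PadicInt.norm_le_one x) h', fun h' => h'.ne⟩

theorem isUnit_add_of_dvd {x y : ℤ_[2]} (hx : IsUnit x) (hy : (2 : ℤ_[2]) ∣ y) :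
    IsUnit (x + y) := by
  rw [isUnit_iff_not_dvd] at *
  rwa [dvd_add_left hy]

theorem two_dvd_pow {r : ℕ} (hr : r ≠ 0) : (2 : ℤ_[2]) ∣ 2 ^ r := dvd_pow_self _ hr

/-! ### Elementary matrices. -/

section Elementary

variable {R : Type*} [CommRing R]

/-- The upper unitriangular matrix with off-diagonal entry `x`. -/
def upper (x : R) : GL (Fin 2) R :=
  ⟨!![1, x; 0, 1], !![1, -x; 0, 1], by simp [Matrix.one_fin_two], by simp [Matrix.one_fin_two]⟩

/-- The lower unitriangular matrix with off-diagonal entry `x`. -/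
def lower (x : R) : GL (Fin 2) R :=
  ⟨!![1, 0; x, 1], !![1, 0; -x, 1], by simp [Matrix.one_fin_two], by simp [Matrix.one_fin_two]⟩

/-- The diagonal matrix with diagonal entries `s` and `1`. -/
def diagLeft (s : Rˣ) : GL (Fin 2) R :=
  ⟨!![(s : R), 0; 0, 1], !![((s⁻¹ : Rˣ) : R), 0; 0, 1], by simp [Matrix.one_fin_two],
    by simp [Matrix.one_fin_two]⟩

@[simp] theorem coe_upper (x : R) : (upper x : Matrix (Fin 2) (Fin 2) R) = !![1, x; 0, 1] := rfl

@[simp] theorem coe_lower (x : R) : (lower x : Matrix (Fin 2) (Fin 2) R) = !![1, 0; x, 1] := rfl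

@[simp] theorem coe_diagLeft (s : Rˣ) :
    (diagLeft s : Matrix (Fin 2) (Fin 2) R) = !![(s : R), 0; 0, 1] := rfl

theorem upper_pow (x : R) (n : ℕ) : upper x ^ n = upper (n * x) := by
  induction n with
  | zero => apply Units.ext; simp [Matrix.one_fin_two]
  | succ n ih =>
    rw [pow_succ, ih]
    apply Units.ext
    simp [add_mul, add_comm]

theorem lower_pow (x : R) (n : ℕ) : lower x ^ n = lower (n * x) := by
  induction n with
  | zero => apply Units.ext; simp [Matrix.one_fin_two]
  | succ n ih =>
    rw [pow_succ, ih]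
    apply Units.ext
    simp [add_mul]

theorem diagLeft_pow (s : Rˣ) (n : ℕ) : diagLeft s ^ n = diagLeft (s ^ n) := by
  induction n with
  | zero => apply Units.ext; simp [Matrix.one_fin_two]
  | succ n ih =>
    rw [pow_succ, ih]
    apply Units.ext
    simp [pow_succ]

theorem det_diagLeft (s : Rˣ) : GeneralLinearGroup.det (diagLeft s) = s := by
  apply Units.ext; simp [Matrix.det_fin_two]

end Elementary

/-- A group containing the elementary matrices of level `2 ^ r` contains the principal congruence
subgroup of `SL₂(ℤ₂)` of level `2 ^ (2 * r)`. -/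
theorem mem_of_elementary {G : Subgroup (GL (Fin 2) ℤ_[2])} {r : ℕ} (hr : r ≠ 0)
    (hU : ∀ x : ℤ_[2], 2 ^ r ∣ x → upper x ∈ G) (hL : ∀ x : ℤ_[2], 2 ^ r ∣ x → lower x ∈ G)
    {x : GL (Fin 2) ℤ_[2]} (hdet : GeneralLinearGroup.det x = 1) (hx : red (2 * r) x = 1) :
    x ∈ G := by
  rw [← map_one (red _), red_eq_iff_dvd] at hx
  have hdet' : x 0 0 * x 1 1 - x 0 1 * x 1 0 = 1 := by
    rw [← Matrix.det_fin_two]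
    exact congrArg Units.val hdet
  obtain ⟨t, ht⟩ := hx 0 0
  have hb := hx 0 1
  have hc := hx 1 0
  simp only [Units.val_one, Matrix.one_apply_eq, ne_eq, zero_ne_one, one_ne_zero,
    not_false_eq_true, Matrix.one_apply_ne, sub_zero, two_mul, pow_add] at ht hb hc
  have hb' := (dvd_mul_right ((2 : ℤ_[2]) ^ r) (2 ^ r)).trans hb
  have hc' := (dvd_mul_right ((2 : ℤ_[2]) ^ r) (2 ^ r)).trans hc
  have ha : IsUnit (x 0 0) := by
    rw [show x 0 0 = 1 + 2 ^ r * 2 ^ r * t by rw [← ht]; ring]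
    exact isUnit_add_of_dvd isUnit_one (((two_dvd_pow hr).mul_right _).mul_right _)
  obtain ⟨a', ha'⟩ := ha.exists_right_inv
  -- With q = 2^r, `upper q * lower (q * t)` already has top-left entry 1 + q²t = x₀₀; this is why
  -- level 2r is needed. One row and one column operation fix the off-diagonal entries, and the
  -- determinant forces the last.
  have hprod : x = lower ((x 1 0 - 2 ^ r * t) * a') * upper (2 ^ r) * lower (2 ^ r * t) *
      upper ((x 0 1 - 2 ^ r) * a') := by
    apply GeneralLinearGroup.ext
    intro i j
    fin_cases i <;> fin_cases j <;> simp
    · linear_combination ht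
    · linear_combination (x 0 1 - 2 ^ r) * a' * ht - (x 0 1 - 2 ^ r) * ha'
    · linear_combination (x 1 0 - 2 ^ r * t) * a' * ht - (x 1 0 - 2 ^ r * t) * ha'
    · linear_combination (x 1 0 - 2 ^ r * t) * a' * ((x 0 1 - 2 ^ r) * a') * ht
        - (x 1 0 - 2 ^ r * t) * ((x 0 1 - 2 ^ r) * a') * ha' + a' * hdet' - a' * ht
        - (x 1 1 - 1) * ha'
  rw [hprod]
  refine G.mul_mem (G.mul_mem (G.mul_mem (hL _ ?_) (hU _ dvd_rfl)) (hL _ (dvd_mul_right _ _)))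
    (hU _ ?_)
  · exact (dvd_sub hc' (dvd_mul_right _ _)).mul_right _
  · exact (dvd_sub hb' dvd_rfl).mul_right _

/-! ### Subgroups of finite index are closed. -/

/-- Every `2`-adic integer sufficiently close to `1` is the `N`-th power of a unit. -/
theorem exists_pow_eq {N : ℕ} (hN : N ≠ 0) : ∃ k : ℕ, ∀ a : ℤ_[2], 2 ^ k ∣ a - 1 →
    ∃ s : ℤ_[2]ˣ, (s : ℤ_[2]) ^ N = a := by
  have hN' : (N : ℤ_[2]) ≠ 0 := by exact_mod_cast hN
  have hpos : 0 < ‖(N : ℤ_[2])‖ ^ 2 := by positivity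
  obtain ⟨k, hk⟩ := exists_pow_lt_of_lt_one hpos (by norm_num : ((2 : ℝ)⁻¹) < 1)
  refine ⟨k + 1, fun a ha => ?_⟩
  have hnorm : ‖a - 1‖ < ‖(N : ℤ_[2])‖ ^ 2 := by
    refine lt_of_le_of_lt ((pow_dvd_iff_norm k _).1 ((pow_dvd_pow _ (by omega)).trans ha)) ?_
    simpa using hk
  obtain ⟨z, hz, -⟩ := hensels_lemma (p := 2) (R := ℤ_[2])
    (F := (Polynomial.X ^ N - Polynomial.C a)) (a := 1) (by
      simpa [norm_sub_rev, Polynomial.derivative_X_pow] using hnorm)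
  have hz' : z ^ N = a := by simpa [sub_eq_zero] using hz
  have ha1 : IsUnit a := by
    have := isUnit_add_of_dvd isUnit_one ((two_dvd_pow (by omega)).trans ha)
    simpa using this
  have hzu : IsUnit z := (isUnit_pow_iff hN).1 (hz' ▸ ha1)
  exact ⟨hzu.unit, by simpa using hz'⟩

theorem exists_eq_two_pow_mul {x : ℤ_[2]} (hx : x ≠ 0) :
    ∃ (n : ℕ) (u : ℤ_[2]), IsUnit u ∧ x = 2 ^ n * u := by
  refine ⟨x.valuation, PadicInt.unitCoeff hx, Units.isUnit _, ?_⟩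
  have := PadicInt.unitCoeff_spec hx
  rw [mul_comm] at this
  exact_mod_cast this

section FiniteIndex

variable {H : Subgroup (GL (Fin 2) ℤ_[2])}

/-- `H` need not be normal, so the exponent bringing x into `H` depends on x but is at most the
index; the factorial serves all x. -/
theorem exists_pow_mem (hH : H.FiniteIndex) : ∃ N : ℕ, N ≠ 0 ∧ ∀ x, x ^ N ∈ H :=
  ⟨_, Nat.factorial_ne_zero H.index, fun x => Subgroup.pow_mem_of_index_ne_zero_of_dvd
    hH.index_ne_zero x fun m _ h => Nat.dvd_factorial ‹_› h⟩

/-- N-th powers put elementary matrices of some level, and all diag(s^N, 1), into `H`. Near 1, det x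
is an N-th power, and dividing x by diag(det x, 1) leaves a product of those elementary matrices. So
`H` is open, hence closed. -/
theorem isClosed_of_finiteIndex (hH : H.FiniteIndex) :
    IsClosed (H : Set (GL (Fin 2) ℤ_[2])) := by
  obtain ⟨N, hN, hpow⟩ := exists_pow_mem hH
  obtain ⟨k, hk⟩ := exists_pow_eq hN
  obtain ⟨v, u, hu, hv⟩ := exists_eq_two_pow_mul (x := (N : ℤ_[2])) (by exact_mod_cast hN)
  have hdvd : ∀ x : ℤ_[2], 2 ^ (v + 1) ∣ x → ∃ y, x = N * y := by
    rintro x ⟨y, rfl⟩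
    obtain ⟨u', hu'⟩ := hu.exists_right_inv
    refine ⟨u' * 2 * y, ?_⟩
    rw [hv]
    linear_combination -(2 ^ v * 2 * y) * hu'
  have hU : ∀ x : ℤ_[2], 2 ^ (v + 1) ∣ x → upper x ∈ H := fun x hx => by
    obtain ⟨y, rfl⟩ := hdvd x hx
    exact upper_pow y N ▸ hpow _
  have hL : ∀ x : ℤ_[2], 2 ^ (v + 1) ∣ x → lower x ∈ H := fun x hx => by
    obtain ⟨y, rfl⟩ := hdvd x hx
    exact lower_pow y N ▸ hpow _
  set n := k + 2 * (v + 1) with hn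
  refine Subgroup.isClosed_of_isOpen _ (Subgroup.isOpen_of_mem_nhds H (g := 1)
    (Filter.mem_of_superset ((isOpen_setOf_red_eq n 1).mem_nhds rfl) fun x hx => ?_))
  have hx1 := (red_eq_iff_dvd _ _ _).1 hx
  have hdet : (2 : ℤ_[2]) ^ n ∣ (x : Matrix (Fin 2) (Fin 2) ℤ_[2]).det - 1 := by
    rw [Matrix.det_fin_two]
    have h00 := hx1 0 0
    have h01 := hx1 0 1
    have h11 := hx1 1 1
    simp only [Units.val_one, Matrix.one_apply_eq, ne_eq, zero_ne_one,
      not_false_eq_true, Matrix.one_apply_ne, sub_zero] at h00 h01 h11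
    have := ((h00.mul_right (x 1 1)).add h11).sub (h01.mul_right (x 1 0))
    convert this using 1
    ring
  obtain ⟨s, hs⟩ := hk _ ((pow_dvd_pow _ (by omega)).trans hdet)
  have hsH : diagLeft (s ^ N) ∈ H := diagLeft_pow s N ▸ hpow _
  have hsdet : s ^ N = GeneralLinearGroup.det x := Units.ext (by simpa using hs)
  have hred : red n (diagLeft (s ^ N)) = 1 := by
    rw [← map_one (red _), red_eq_iff_dvd]
    intro i j
    fin_cases i <;> fin_cases j <;> simp [hs, hdet]
  have hmem : (diagLeft (s ^ N))⁻¹ * x ∈ H := by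
    refine mem_of_elementary (by omega) hU hL (by simp [det_diagLeft, hsdet]) ?_
    rw [← map_one (red _)]
    refine red_eq_of_le (show 2 * (v + 1) ≤ n by omega) ?_
    rw [map_mul, map_inv, hred, show red n x = red n 1 from hx]
    simp
  simpa using H.mul_mem hsH hmem

end FiniteIndex

/-! ### Criteria for finite index and for full determinant. -/

theorem exists_mem_det_eq {M : Subgroup (GL (Fin 2) ℤ_[2])}
    (hdet : M.map GeneralLinearGroup.det = ⊤) (u : ℤ_[2]ˣ) :
    ∃ x ∈ M, GeneralLinearGroup.det x = u := by
  have : u ∈ M.map GeneralLinearGroup.det := hdet ▸ Subgroup.mem_top u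
  exact Subgroup.mem_map.1 this

/-- Full determinant gives each coset a representative of determinant 1, and its reduction mod
2^(2r) determines the coset. -/
theorem finiteIndex_of_elementary {M : Subgroup (GL (Fin 2) ℤ_[2])} {r : ℕ} (hr : r ≠ 0)
    (hU : ∀ x : ℤ_[2], 2 ^ r ∣ x → upper x ∈ M) (hL : ∀ x : ℤ_[2], 2 ^ r ∣ x → lower x ∈ M)
    (hdet : M.map GeneralLinearGroup.det = ⊤) : M.FiniteIndex := by
  have hrep : ∀ q : GL (Fin 2) ℤ_[2] ⧸ M, ∃ x : GL (Fin 2) ℤ_[2],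
      (x : GL (Fin 2) ℤ_[2] ⧸ M) = q ∧ GeneralLinearGroup.det x = 1 := by
    intro q
    induction q using QuotientGroup.induction_on with
    | H x =>
      obtain ⟨m, hm, hmx⟩ := exists_mem_det_eq hdet (GeneralLinearGroup.det x)⁻¹
      exact ⟨x * m, (QuotientGroup.mk_mul_of_mem x hm), by simp [hmx]⟩
  choose f hf hf1 using hrep
  have hinj : Function.Injective fun q => red (2 * r) (f q) := by
    intro p q hpq
    rw [← hf p, ← hf q, QuotientGroup.eq]
    refine mem_of_elementary hr hU hL (by simp [hf1]) ?_
    simp only at hpq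
    simp [hpq]
  have : Finite (GL (Fin 2) ℤ_[2] ⧸ M) := Finite.of_injective _ hinj
  exact Subgroup.finiteIndex_of_finite_quotient

/-- A closed subgroup of `ℤ₂ˣ` containing `-1` and a unit congruent to `5` modulo `8` is
everything. -/
theorem units_eq_top {C : Subgroup ℤ_[2]ˣ} (hC : IsClosed (C : Set ℤ_[2]ˣ)) (hneg : -1 ∈ C)
    {u : ℤ_[2]ˣ} (hu : u ∈ C) {w : ℤ_[2]} (hw : IsUnit w) (huw : (u : ℤ_[2]) = 1 + 4 * w) :
    C = ⊤ := by
  -- Each squaring raises the valuation of u - 1 by exactly one, so these powers correct any digit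
  -- from the third on; -1 handles the residue mod 4.
  have hpow : ∀ n : ℕ, ∃ w : ℤ_[2], IsUnit w ∧
      ((u ^ 2 ^ n : ℤ_[2]ˣ) : ℤ_[2]) = 1 + 2 ^ (n + 2) * w := by
    intro n
    induction n with
    | zero => exact ⟨w, hw, by rw [pow_zero, pow_one, huw]; ring⟩
    | succ n ih =>
      obtain ⟨w, hw, h⟩ := ih
      refine ⟨w + 2 * (2 ^ n * w ^ 2), isUnit_add_of_dvd hw (dvd_mul_right _ _), ?_⟩
      rw [pow_succ 2 n, pow_mul, Units.val_pow_eq_pow_val, h]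
      ring
  have hodd : ∀ {x y : ℤ_[2]}, IsUnit x → IsUnit y → (2 : ℤ_[2]) ∣ x - y := by
    intro x y hx hy
    by_contra h
    rw [← isUnit_iff_not_dvd, isUnit_iff_not_dvd] at h
    have h1 := toZModPow_eq_iff 1 x y
    have key : ∀ a b : ZMod (2 ^ 1), IsUnit a → IsUnit b → a = b := by decide
    exact h (by simpa using h1.1 (key _ _ (hx.map _) (hy.map _)))
  have happ : ∀ (t : ℤ_[2]ˣ) (n : ℕ), ∃ c ∈ C, (2 : ℤ_[2]) ^ (n + 2) ∣ (c : ℤ_[2]) - t := by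
    intro t n
    induction n with
    | zero =>
      obtain ⟨y, hy⟩ := hodd isUnit_one t.isUnit
      by_cases h : (2 : ℤ_[2]) ∣ y
      · obtain ⟨z, rfl⟩ := h
        exact ⟨1, C.one_mem, z, by simp [hy]; ring⟩
      · obtain ⟨z, hz⟩ := hodd isUnit_one ((isUnit_iff_not_dvd y).2 h)
        refine ⟨-1, hneg, -z, ?_⟩
        push_cast
        linear_combination hy - 2 * hz
    | succ n ih =>
      obtain ⟨c, hc, y, hy⟩ := ih
      by_cases h : (2 : ℤ_[2]) ∣ y
      · obtain ⟨z, rfl⟩ := h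
        exact ⟨c, hc, z, by rw [hy]; ring⟩
      · obtain ⟨w, hw, h'⟩ := hpow n
        obtain ⟨z, hz⟩ := hodd ((isUnit_iff_not_dvd y).2 h) (c.isUnit.mul hw).neg
        refine ⟨c * u ^ 2 ^ n, C.mul_mem hc (C.pow_mem hu _), z, ?_⟩
        rw [Units.val_mul, h']
        linear_combination hy + 2 ^ (n + 2) * hz
  refine (Subgroup.eq_top_iff' C).2 fun t => ?_
  choose c hc hct using happ t
  have hemb : Topology.IsClosedEmbedding fun x : ℤ_[2]ˣ => (x : ℤ_[2]) :=
    Units.continuous_val.isClosedEmbedding Units.val_injective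
  have htend : Filter.Tendsto (fun n => (c n : ℤ_[2])) Filter.atTop (nhds (t : ℤ_[2])) := by
    have := tendsto_zero_of_dvd fun n => (pow_dvd_pow 2 (by omega : n ≤ n + 2)).trans (hct n)
    simpa using this.add_const (t : ℤ_[2])
  exact hC.mem_of_tendsto (hemb.tendsto_nhds_iff.2 htend) (Filter.Eventually.of_forall hc)

/-! ### Openness up to scalars. -/

theorem sq_eq_trace_det {R : Type*} [CommRing R] (g : Matrix (Fin 2) (Fin 2) R) :
    g * g = g.trace • g - g.det • (1 : Matrix (Fin 2) (Fin 2) R) := by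
  ext i j
  fin_cases i <;> fin_cases j <;>
    simp [Matrix.mul_apply, Fin.sum_univ_two, Matrix.trace_fin_two, Matrix.det_fin_two] <;> ring

/-- Cayley–Hamilton gives g² = -det g + (tr g) g. Squaring s + 2^m u g then yields the g-coefficient
2^(m+1) us + 2^(2m) u² tr g; as tr g is even and m ≥ 1, its valuation is exactly m + 1. -/
theorem exists_pow_eq_scalar_add {g : Matrix (Fin 2) (Fin 2) ℤ_[2]} (hd : IsUnit g.det)
    (ht : (2 : ℤ_[2]) ∣ g.trace) (ht0 : g.trace ≠ 0) : ∃ m₀ : ℕ, ∀ m ≥ m₀, ∃ (k : ℕ) (s u : ℤ_[2]),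
      IsUnit s ∧ IsUnit u ∧ g ^ k = s • 1 + (2 ^ m * u) • g := by
  obtain ⟨v, u, hu, hv⟩ := exists_eq_two_pow_mul ht0
  have hv0 : v ≠ 0 := by
    rintro rfl
    rw [hv, pow_zero, one_mul] at ht
    exact (isUnit_iff_not_dvd u).1 hu ht
  obtain ⟨v, rfl⟩ := Nat.exists_eq_succ_of_ne_zero hv0
  refine ⟨v + 1, fun m hm => ?_⟩
  obtain ⟨i, rfl⟩ := Nat.exists_eq_add_of_le hm
  refine ⟨2 ^ (i + 1), ?_⟩
  clear hm
  induction i with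
  | zero =>
    refine ⟨-g.det, u, hd.neg, hu, ?_⟩
    rw [zero_add, pow_one, pow_two, sq_eq_trace_det, hv]
    simp only [neg_smul]
    abel
  | succ i ih =>
    obtain ⟨s, w, hs, hw, h⟩ := ih
    have h2 : ∀ x : ℤ_[2], (2 : ℤ_[2]) ∣ 2 ^ (v + 1 + i) * x := fun x =>
      (two_dvd_pow (by omega)).mul_right _
    refine ⟨s ^ 2 + 2 ^ (v + 1 + i) * (-(2 ^ (v + 1 + i) * w ^ 2 * g.det)),
      w * (s + 2 ^ (v + 1 + i) * (w * 2 ^ v * u)), isUnit_add_of_dvd (hs.pow 2) (h2 _),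
      hw.mul (isUnit_add_of_dvd hs (h2 _)), ?_⟩
    rw [pow_succ 2 (i + 1), pow_mul, h, pow_two, add_mul, mul_add, mul_add]
    simp only [smul_mul_smul_comm, mul_one, one_mul, sq_eq_trace_det g, hv,
      Nat.succ_eq_add_one, pow_succ]
    module

/-- A denominator-free form of the fact that 1, g, h, gh span the matrix algebra once det(gh - hg)
is invertible. -/
theorem det_commutator_smul {R : Type*} [CommRing R] (g h E : Matrix (Fin 2) (Fin 2) R) :
    (g * h - h * g).det • E =
      (-(E * h.adjugate * (g * h - h * g) * g.adjugate).trace) • (1 : Matrix (Fin 2) (Fin 2) R) +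
      (E * h.adjugate * (g * h - h * g)).trace • g +
      (E * (g * h - h * g) * g.adjugate).trace • h + (-(E * (g * h - h * g)).trace) • (g * h) := by
  ext i j
  fin_cases i <;> fin_cases j <;>
    simp [Matrix.mul_apply, Fin.sum_univ_two, Matrix.trace_fin_two, Matrix.det_fin_two,
      Matrix.adjugate_fin_two] <;> ring

theorem one_add_smul_pow {q a : ℤ_[2]} (g : Matrix (Fin 2) (Fin 2) ℤ_[2]) (n : ℕ) :
    ∃ F : Matrix (Fin 2) (Fin 2) ℤ_[2],
      (1 + (q * a) • g) ^ n = 1 + (q * (n * a)) • g + q ^ 2 • F := by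
  induction n with
  | zero => exact ⟨0, by simp⟩
  | succ n ih =>
    obtain ⟨F, hF⟩ := ih
    refine ⟨F + (n * a ^ 2) • (g * g) + (q * a) • (F * g), ?_⟩
    rw [pow_succ, hF]
    simp only [add_mul, mul_add, mul_one, one_mul, smul_add, smul_mul_assoc, mul_smul_comm]
    push_cast
    module

theorem one_add_smul_mul (q : ℤ_[2]) (A B F G : Matrix (Fin 2) (Fin 2) ℤ_[2]) :
    ∃ X : Matrix (Fin 2) (Fin 2) ℤ_[2],
      (1 + q • A + q ^ 2 • F) * (1 + q • B + q ^ 2 • G) = 1 + q • (A + B) + q ^ 2 • X := by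
  refine ⟨F + G + A * B + q • (A * G) + q • (F * B) + q ^ 2 • (F * G), ?_⟩
  simp only [add_mul, mul_add, mul_one, one_mul, smul_add, smul_mul_assoc, mul_smul_comm]
  module

theorem exists_nat_dvd_sub (m : ℕ) (x : ℤ_[2]) : ∃ n : ℕ, (2 : ℤ_[2]) ^ m ∣ x - n := by
  refine ⟨x.appr m, ?_⟩
  have := PadicInt.appr_spec m x
  rw [Ideal.mem_span_singleton] at this
  exact_mod_cast this

/-- The subgroup generated by `M` and the scalar matrices. -/
def withScalars (M : Subgroup (GL (Fin 2) ℤ_[2])) : Subgroup (GL (Fin 2) ℤ_[2]) where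
  carrier := {x | ∃ z : ℤ_[2]ˣ, GeneralLinearGroup.scalar (Fin 2) z * x ∈ M}
  one_mem' := ⟨1, by simp [M.one_mem]⟩
  mul_mem' := by
    rintro x y ⟨z, hz⟩ ⟨w, hw⟩
    refine ⟨z * w, ?_⟩
    have := M.mul_mem hz hw
    rwa [mul_assoc, ← mul_assoc x, ← GeneralLinearGroup.scalar_commute, mul_assoc, ← mul_assoc,
      ← map_mul] at this
  inv_mem' := by
    rintro x ⟨z, hz⟩
    refine ⟨z⁻¹, ?_⟩
    have := M.inv_mem hz
    rwa [_root_.mul_inv_rev, ← map_inv, ← GeneralLinearGroup.scalar_commute] at this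

theorem scalar_mem_withScalars (M : Subgroup (GL (Fin 2) ℤ_[2])) (z : ℤ_[2]ˣ) :
    GeneralLinearGroup.scalar (Fin 2) z ∈ withScalars M :=
  ⟨z⁻¹, by rw [← map_mul, inv_mul_cancel, map_one]; exact M.one_mem⟩

theorem le_withScalars (M : Subgroup (GL (Fin 2) ℤ_[2])) : M ≤ withScalars M :=
  fun x hx => ⟨1, by simpa using hx⟩

theorem continuous_scalar :
    Continuous (GeneralLinearGroup.scalar (Fin 2) : ℤ_[2]ˣ →* GL (Fin 2) ℤ_[2]) := by
  have h : Continuous fun x : ℤ_[2] => Matrix.scalar (Fin 2) x :=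
    continuous_matrix fun i j => by
      by_cases hij : i = j
      · subst hij; simpa using continuous_id'
      · simpa [hij] using continuous_const
  exact Units.continuous_iff.2 ⟨h.comp Units.continuous_val, h.comp Units.continuous_coe_inv⟩

theorem isClosed_withScalars {M : Subgroup (GL (Fin 2) ℤ_[2])}
    (hM : IsClosed (M : Set (GL (Fin 2) ℤ_[2]))) :
    IsClosed (withScalars M : Set (GL (Fin 2) ℤ_[2])) := by
  have : (withScalars M : Set (GL (Fin 2) ℤ_[2])) =
      (fun p : ℤ_[2]ˣ × GL (Fin 2) ℤ_[2] => GeneralLinearGroup.scalar (Fin 2) p.1 * p.2) ''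
        (Set.univ ×ˢ (M : Set (GL (Fin 2) ℤ_[2]))) := by
    ext x
    constructor
    · rintro ⟨z, hz⟩
      exact ⟨(z⁻¹, _), ⟨trivial, hz⟩, by simp [← mul_assoc]⟩
    · rintro ⟨⟨z, y⟩, ⟨-, hy⟩, rfl⟩
      exact mul_mem (scalar_mem_withScalars M z) (le_withScalars M hy)
  rw [this]
  refine ((isCompact_univ.prod hM.isCompact).image ?_).isClosed
  exact (continuous_scalar.comp continuous_fst).mul continuous_snd

/-- Scalars are central and cancel in commutators; this is the way back to `M`. -/
theorem commutator_mem_of_withScalars {M : Subgroup (GL (Fin 2) ℤ_[2])} {x y : GL (Fin 2) ℤ_[2]}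
    (hx : x ∈ withScalars M) (hy : y ∈ withScalars M) : x * y * x⁻¹ * y⁻¹ ∈ M := by
  obtain ⟨z, hz⟩ := hx
  obtain ⟨w, hw⟩ := hy
  have := M.mul_mem (M.mul_mem (M.mul_mem hz hw) (M.inv_mem hz)) (M.inv_mem hw)
  convert this using 1
  have hzc := fun a => GeneralLinearGroup.scalar_commute (n := Fin 2) z a
  have hwc := fun a => GeneralLinearGroup.scalar_commute (n := Fin 2) w a
  generalize GeneralLinearGroup.scalar (Fin 2) z = Z at *
  generalize GeneralLinearGroup.scalar (Fin 2) w = W at *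
  have h₁ : ∀ b, Z * x * b * (Z * x)⁻¹ = x * b * x⁻¹ := fun b => by
    rw [mul_inv_eq_iff_eq_mul, hzc x, mul_assoc x Z b, hzc b]
    group
  rw [h₁, ← mul_assoc x W, ← hwc x, eq_mul_inv_iff_mul_eq, ← mul_assoc]
  rw [← hwc]
  simp [mul_assoc]

theorem exists_mem_withScalars_approx {M : Subgroup (GL (Fin 2) ℤ_[2])} {g : GL (Fin 2) ℤ_[2]}
    (hg : g ∈ M) (ht : (2 : ℤ_[2]) ∣ g.val.trace) (ht0 : g.val.trace ≠ 0) :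
    ∃ m₀ : ℕ, ∀ m ≥ m₀, ∀ e : ℤ_[2], ∃ x ∈ withScalars M, ∃ F : Matrix (Fin 2) (Fin 2) ℤ_[2],
      x.val = 1 + (2 : ℤ_[2]) ^ m • (e • g.val) + ((2 : ℤ_[2]) ^ m) ^ 2 • F := by
  obtain ⟨m₀, h⟩ := exists_pow_eq_scalar_add ((Matrix.isUnit_iff_isUnit_det _).1 g.isUnit) ht ht0
  refine ⟨m₀, fun m hm e => ?_⟩
  obtain ⟨k, s, u, ⟨s, rfl⟩, ⟨u, rfl⟩, hk⟩ := h m hm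
  set w : ℤ_[2]ˣ := s⁻¹ * u with hw
  have hx₀ : (GeneralLinearGroup.scalar (Fin 2) s⁻¹ * g ^ k).val =
      1 + (2 ^ m * (w : ℤ_[2])) • g.val := by
    rw [Units.val_mul, Units.val_pow_eq_pow_val, hk, GeneralLinearGroup.coe_scalar,
      Matrix.scalar_apply, ← Matrix.smul_one_eq_diagonal, smul_mul_assoc, one_mul, smul_add,
      smul_smul, smul_smul, hw]
    simp only [Units.inv_mul, one_smul, Units.val_mul]
    congr 2
    ring
  -- The exponent n ≡ e w⁻¹ mod 2^m turns 2^m w g into 2^m e g up to an error of order 2^(2m).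
  obtain ⟨n, f, hf⟩ := exists_nat_dvd_sub m (e * ((w⁻¹ : ℤ_[2]ˣ) : ℤ_[2]))
  obtain ⟨F, hF⟩ := one_add_smul_pow (q := 2 ^ m) (a := (w : ℤ_[2])) g.val n
  refine ⟨(GeneralLinearGroup.scalar (Fin 2) s⁻¹ * g ^ k) ^ n,
    pow_mem (mul_mem (scalar_mem_withScalars M _) (le_withScalars M (pow_mem hg k))) n,
    F - (f * w) • g.val, ?_⟩
  rw [Units.val_pow_eq_pow_val, hx₀, hF]
  have hn : (n * w : ℤ_[2]) = e - 2 ^ m * f * w := by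
    linear_combination (e : ℤ_[2]) * w.inv_mul - (w : ℤ_[2]) * hf
  rw [hn]
  module

/-- If `g`, `h` generate the matrix algebra over `ℚ₂` and `g`, `h`, `gh` have nonzero even trace,
then a closed subgroup containing `g` and `h` is, up to scalars, open. -/
theorem exists_red_eq_one_mem_withScalars {M : Subgroup (GL (Fin 2) ℤ_[2])}
    (hM : IsClosed (M : Set (GL (Fin 2) ℤ_[2]))) {g h : GL (Fin 2) ℤ_[2]} (hg : g ∈ M) (hh : h ∈ M)
    (hgt : (2 : ℤ_[2]) ∣ g.val.trace) (hht : (2 : ℤ_[2]) ∣ h.val.trace)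
    (hght : (2 : ℤ_[2]) ∣ (g * h).val.trace) (hg0 : g.val.trace ≠ 0) (hh0 : h.val.trace ≠ 0)
    (hgh0 : (g * h).val.trace ≠ 0) (hdet : (g.val * h.val - h.val * g.val).det ≠ 0) :
    ∃ j : ℕ, j ≠ 0 ∧ ∀ x, red j x = 1 → x ∈ withScalars M := by
  obtain ⟨m₁, h₁⟩ := exists_mem_withScalars_approx hg hgt hg0
  obtain ⟨m₂, h₂⟩ := exists_mem_withScalars_approx hh hht hh0
  obtain ⟨m₃, h₃⟩ := exists_mem_withScalars_approx (mul_mem hg hh) hght hgh0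
  obtain ⟨c, u, ⟨u, rfl⟩, hc⟩ := exists_eq_two_pow_mul hdet
  refine ⟨m₁ + m₂ + m₃ + 2 * c + 1, by omega,
    fun x hx => mem_of_approx (isClosed_withScalars hM) (fun j hj E => ?_) hx⟩
  -- The factor 2^c is the denominator for expressing E through 1, g, h, gh, so one works at level m
  -- = j - c. Errors have order 2^(2m), and m ≥ c + 1 makes 2m ≥ j + 1.
  obtain ⟨m, rfl⟩ : ∃ m, j = m + c := ⟨j - c, by omega⟩
  obtain ⟨d, hd⟩ : ∃ d, m = c + 1 + d := ⟨m - (c + 1), by omega⟩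
  obtain ⟨e₀, e₁, e₂, e₃, he⟩ : ∃ e₀ e₁ e₂ e₃ : ℤ_[2], (2 : ℤ_[2]) ^ c • E =
      e₀ • 1 + e₁ • g.val + e₂ • h.val + e₃ • (g * h).val := by
    refine ⟨_, _, _, _, Eq.trans ?_
      (det_commutator_smul g.val h.val (((u⁻¹ : ℤ_[2]ˣ) : ℤ_[2]) • E))⟩
    rw [hc, smul_smul, mul_assoc, Units.mul_inv, mul_one]
  have hs : IsUnit (1 + 2 ^ m * e₀) :=
    isUnit_add_of_dvd isUnit_one ((two_dvd_pow (by omega)).mul_right _)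
  obtain ⟨s, hs⟩ := hs
  obtain ⟨x₁, hx₁, F₁, hF₁⟩ := h₁ m (by omega) e₁
  obtain ⟨x₂, hx₂, F₂, hF₂⟩ := h₂ m (by omega) e₂
  obtain ⟨x₃, hx₃, F₃, hF₃⟩ := h₃ m (by omega) e₃
  have hF₀ : (GeneralLinearGroup.scalar (Fin 2) s).val =
      1 + (2 : ℤ_[2]) ^ m • (e₀ • 1) + ((2 : ℤ_[2]) ^ m) ^ 2 • 0 := by
    rw [GeneralLinearGroup.coe_scalar, Matrix.scalar_apply, ← Matrix.smul_one_eq_diagonal, hs]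
    module
  refine ⟨GeneralLinearGroup.scalar (Fin 2) s * x₁ * x₂ * x₃,
    mul_mem (mul_mem (mul_mem (scalar_mem_withScalars M s) hx₁) hx₂) hx₃, ?_⟩
  obtain ⟨G₁, hG₁⟩ := one_add_smul_mul (2 ^ m) (e₀ • 1) (e₁ • g.val) 0 F₁
  obtain ⟨G₂, hG₂⟩ := one_add_smul_mul (2 ^ m) (e₀ • 1 + e₁ • g.val) (e₂ • h.val) G₁ F₂
  obtain ⟨G₃, hG₃⟩ := one_add_smul_mul (2 ^ m) (e₀ • 1 + e₁ • g.val + e₂ • h.val)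
    (e₃ • (g * h).val) G₂ F₃
  refine ⟨(2 : ℤ_[2]) ^ d • G₃, ?_⟩
  rw [Units.val_mul, Units.val_mul, Units.val_mul, hF₀, hF₁, hF₂, hF₃, hG₁, hG₂, hG₃, ← he,
    smul_smul, ← pow_add, smul_smul, ← pow_add, ← pow_mul, show m * 2 = m + c + 1 + d by omega]

/-- The commutator of diag(1 + 2^j, 1) with `upper (2 ^ j * y)` is `upper (2 ^ (2 * j) * y)`; for
lower matrices the inverse diagonal plays the same role. -/
theorem exists_elementary_mem {M : Subgroup (GL (Fin 2) ℤ_[2])} {j : ℕ} (hj : j ≠ 0)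
    (h : ∀ x, red j x = 1 → x ∈ withScalars M) :
    (∀ x : ℤ_[2], 2 ^ (2 * j) ∣ x → upper x ∈ M) ∧ ∀ x : ℤ_[2], 2 ^ (2 * j) ∣ x → lower x ∈ M := by
  have hs : IsUnit (1 + 2 ^ j : ℤ_[2]) := isUnit_add_of_dvd isUnit_one (two_dvd_pow hj)
  obtain ⟨s, hs⟩ := hs
  have hmem : diagLeft s ∈ withScalars M := by
    refine h _ ?_
    rw [← map_one (red j), red_eq_iff_dvd]
    intro i k
    fin_cases i <;> fin_cases k <;> simp [hs]
  have hup : ∀ y : ℤ_[2], 2 ^ j ∣ y → upper y ∈ withScalars M := fun y hy => h _ <| by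
    rw [← map_one (red j), red_eq_iff_dvd]
    intro i k
    fin_cases i <;> fin_cases k <;> simp [hy]
  have hlo : ∀ y : ℤ_[2], 2 ^ j ∣ y → lower y ∈ withScalars M := fun y hy => h _ <| by
    rw [← map_one (red j), red_eq_iff_dvd]
    intro i k
    fin_cases i <;> fin_cases k <;> simp [hy]
  constructor
  · rintro x ⟨y, rfl⟩
    have := commutator_mem_of_withScalars hmem (hup (2 ^ j * y) (dvd_mul_right _ _))
    convert this using 1
    rw [eq_mul_inv_iff_mul_eq, eq_mul_inv_iff_mul_eq]
    apply Units.ext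
    simp [hs]
    ring
  · rintro x ⟨y, rfl⟩
    have := commutator_mem_of_withScalars (inv_mem hmem) (hlo (2 ^ j * y) (dvd_mul_right _ _))
    convert this using 1
    rw [eq_mul_inv_iff_mul_eq, inv_inv, mul_assoc, eq_inv_mul_iff_mul_eq]
    apply Units.ext
    simp [hs]
    ring

/-! ### General position. -/

theorem eventually_quadratic_ne_zero {a b c q : ℤ_[2]} (hq : q ≠ 0)
    (h : ¬ (a = 0 ∧ b = 0 ∧ c = 0)) :
    ∀ᶠ n : ℕ in Filter.atTop, a * (q * n) ^ 2 + b * (q * n) + c ≠ 0 := by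
  open Polynomial in
  have hP : C a * X ^ 2 + C b * X + C c ≠ 0 := by
    intro hP
    refine h ⟨?_, ?_, ?_⟩
    · simpa using congrArg (fun p => Polynomial.coeff p 2) hP
    · simpa using congrArg (fun p => Polynomial.coeff p 1) hP
    · simpa using congrArg (fun p => Polynomial.coeff p 0) hP
  have hinj : Function.Injective fun n : ℕ => q * (n : ℤ_[2]) := fun m n hmn => by
    simpa [hq] using hmn
  rw [← Nat.cofinite_eq_atTop, Filter.eventually_cofinite]
  refine ((Polynomial.finite_setOfPred_isRoot hP).preimage hinj.injOn).subset fun n hn => ?_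
  simpa [Polynomial.IsRoot] using hn

theorem eventually_linear_ne_zero {b c q : ℤ_[2]} (hq : q ≠ 0) (h : ¬ (b = 0 ∧ c = 0)) :
    ∀ᶠ n : ℕ in Filter.atTop, b * (q * n) + c ≠ 0 := by
  have := eventually_quadratic_ne_zero (a := 0) hq (fun h' => h h'.2)
  simpa using this

theorem row_ne_zero (x : GL (Fin 2) ℤ_[2]) (i : Fin 2) : ¬ (x i 1 = 0 ∧ x i 0 = 0) := by
  rintro ⟨h₁, h₂⟩
  have hx := GeneralLinearGroup.det_ne_zero x
  rw [Matrix.det_fin_two] at hx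
  fin_cases i <;> simp_all

/-- Only the leading coefficient matters: it is g₁₀ det(gv | v), with v the first column of h, so it
is nonzero when g₁₀ ≠ 0 and v is not an eigenvector of g. -/
theorem det_commutator_mul_upper {R : Type*} [CommRing R] (g h : Matrix (Fin 2) (Fin 2) R) :
    ∃ b c : R, ∀ x : R, (g * (h * !![1, x; 0, 1]) - h * !![1, x; 0, 1] * g).det =
      g 1 0 * (g 0 1 * h 1 0 ^ 2 + (g 0 0 - g 1 1) * h 0 0 * h 1 0 - g 1 0 * h 0 0 ^ 2) * x ^ 2 +
        b * x + c := by
  set C := g * h - h * g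
  set P := g * h * !![0, 1; 0, 0] - h * !![0, 1; 0, 0] * g
  refine ⟨C 0 0 * P 1 1 + C 1 1 * P 0 0 - C 0 1 * P 1 0 - C 1 0 * P 0 1, C.det, fun x => ?_⟩
  simp [C, P, Matrix.mul_apply, Fin.sum_univ_two, Matrix.det_fin_two]
  ring

/-- Any two elements of `GL₂(ℤ₂)` can be moved into general position by multiplying them with
elementary matrices whose entries are multiples of `q`. -/
theorem exists_generic (g₀ h₀ : GL (Fin 2) ℤ_[2]) {q : ℤ_[2]} (hq : q ≠ 0) :
    ∃ k l m n : ℕ, ∃ g h : GL (Fin 2) ℤ_[2],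
      g = g₀ * lower (q * k) * upper (q * l) ∧ h = h₀ * lower (q * m) * upper (q * n) ∧
      g.val.trace ≠ 0 ∧ h.val.trace ≠ 0 ∧ (g * h).val.trace ≠ 0 ∧
      (g.val * h.val - h.val * g.val).det ≠ 0 := by
  obtain ⟨k, hk⟩ := (eventually_linear_ne_zero hq (row_ne_zero g₀ 1)).exists
  obtain ⟨g₁, hg₁⟩ : ∃ g₁, g₁ = g₀ * lower (q * k) := ⟨_, rfl⟩
  have hg₁0 : g₁ 1 0 ≠ 0 := by
    convert hk using 1
    simp [hg₁, Matrix.mul_apply, Fin.sum_univ_two]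
    ring
  obtain ⟨l, hl⟩ := (eventually_linear_ne_zero (c := g₁.val.trace) hq (fun h => hg₁0 h.1)).exists
  obtain ⟨g, hg⟩ : ∃ g, g = g₁ * upper (q * l) := ⟨_, rfl⟩
  have hg0 : g 1 0 ≠ 0 := by
    convert hg₁0 using 1
    simp [hg, Matrix.mul_apply, Fin.sum_univ_two]
  have hgt : g.val.trace ≠ 0 := by
    convert hl using 1
    simp [hg, Matrix.mul_apply, Fin.sum_univ_two, Matrix.trace_fin_two]
    ring
  -- These are the coefficients, in the entry y of `lower y`, of det(gv | v) for v the first column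
  -- of h₀ · `lower y`. If all vanished, invertibility of h₀ would make the whole form det(gv | v)
  -- zero, against g₁₀ ≠ 0.
  have hquad : ¬ (g 0 1 * h₀ 1 1 ^ 2 + (g 0 0 - g 1 1) * h₀ 0 1 * h₀ 1 1 - g 1 0 * h₀ 0 1 ^ 2 = 0 ∧
      2 * g 0 1 * h₀ 1 0 * h₀ 1 1 + (g 0 0 - g 1 1) * (h₀ 0 0 * h₀ 1 1 + h₀ 0 1 * h₀ 1 0) -
        2 * g 1 0 * h₀ 0 0 * h₀ 0 1 = 0 ∧
      g 0 1 * h₀ 1 0 ^ 2 + (g 0 0 - g 1 1) * h₀ 0 0 * h₀ 1 0 - g 1 0 * h₀ 0 0 ^ 2 = 0) := by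
    rintro ⟨ha, hb, hc⟩
    have hdet := GeneralLinearGroup.det_ne_zero h₀
    refine mul_ne_zero hg0 (pow_ne_zero 2 hdet) ?_
    rw [Matrix.det_fin_two]
    linear_combination h₀ 1 0 * h₀ 1 1 * hb - h₀ 1 1 ^ 2 * hc - h₀ 1 0 ^ 2 * ha
  obtain ⟨m, ⟨hm₁, hm₂⟩, hm₃⟩ := (((eventually_linear_ne_zero hq (row_ne_zero h₀ 1)).and
    (eventually_linear_ne_zero hq (row_ne_zero (g * h₀) 1))).and
      (eventually_quadratic_ne_zero hq hquad)).exists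
  obtain ⟨h₁, hh₁⟩ : ∃ h₁, h₁ = h₀ * lower (q * m) := ⟨_, rfl⟩
  have hh₁0 : h₁ 1 0 ≠ 0 := by
    convert hm₁ using 1
    simp [hh₁, Matrix.mul_apply, Fin.sum_univ_two]
    ring
  have hgh₁0 : (g * h₁) 1 0 ≠ 0 := by
    convert hm₂ using 1
    simp [hh₁, Matrix.mul_apply, Fin.sum_univ_two]
    ring
  have hQ : g 0 1 * h₁ 1 0 ^ 2 + (g 0 0 - g 1 1) * h₁ 0 0 * h₁ 1 0 - g 1 0 * h₁ 0 0 ^ 2 ≠ 0 := by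
    convert hm₃ using 1
    simp [hh₁, Matrix.mul_apply, Fin.sum_univ_two]
    ring
  obtain ⟨b, c, hbc⟩ := det_commutator_mul_upper g.val h₁.val
  obtain ⟨n, ⟨hn₁, hn₂⟩, hn₃⟩ := (((eventually_linear_ne_zero (c := h₁.val.trace) hq
    (fun h => hh₁0 h.1)).and (eventually_linear_ne_zero (c := (g * h₁).val.trace) hq
      (fun h => hgh₁0 h.1))).and
      (eventually_quadratic_ne_zero (b := b) (c := c) hq
        (fun h => mul_ne_zero hg0 hQ h.1))).exists
  refine ⟨k, l, m, n, g, h₁ * upper (q * n), by rw [hg, hg₁], by rw [hh₁], hgt, ?_, ?_, ?_⟩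
  · convert hn₁ using 1
    simp [Matrix.mul_apply, Fin.sum_univ_two, Matrix.trace_fin_two]
    ring
  · convert hn₂ using 1
    simp [Matrix.mul_apply, Fin.sum_univ_two, Matrix.trace_fin_two]
    ring
  · rw [← hbc] at hn₃
    exact hn₃

/-! ### Choice of the two generators inside `H`. -/

theorem exists_units_val_eq (a : ℤ_[2]) (ha : ¬ (2 : ℤ_[2]) ∣ a) : ∃ u : ℤ_[2]ˣ, (u : ℤ_[2]) = a :=
  (isUnit_iff_not_dvd a).2 ha

theorem GL_two_pow_six (σ : GL (Fin 2) (ZMod (2 ^ 1))) : σ ^ 6 = 1 := by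
  have key : ∀ a b c d : ZMod (2 ^ 1), a * d - b * c ≠ 0 → !![a, b; c, d] ^ 6 = 1 := by decide
  apply Units.ext
  rw [Units.val_pow_eq_pow_val, Matrix.eta_fin_two σ.val]
  apply key
  rw [← Matrix.det_fin_two]
  have : Nontrivial (ZMod (2 ^ 1)) := inferInstanceAs (Nontrivial (ZMod 2))
  exact σ.det.ne_zero

/-- GL₂(𝔽₂) is S₃: two elements of order at most 2 commute, or are distinct transpositions and
satisfy the braid relation. -/
theorem GL_two_conj_of_sq {σ τ : GL (Fin 2) (ZMod (2 ^ 1))} (hσ : σ ^ 2 = 1) (hτ : τ ^ 2 = 1) :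
    σ * τ = τ * σ ∨ τ * σ * τ * σ * τ = σ := by
  have key : ∀ a b c d a' b' c' d' : ZMod (2 ^ 1), !![a, b; c, d] ^ 2 = 1 →
      !![a', b'; c', d'] ^ 2 = 1 →
      (!![a, b; c, d] * !![a', b'; c', d'] = !![a', b'; c', d'] * !![a, b; c, d] ∨
      !![a', b'; c', d'] * !![a, b; c, d] * !![a', b'; c', d'] * !![a, b; c, d] *
        !![a', b'; c', d'] = !![a, b; c, d]) := by decide
  have := key (σ 0 0) (σ 0 1) (σ 1 0) (σ 1 1) (τ 0 0) (τ 0 1) (τ 1 0) (τ 1 1)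
  simp only [← Matrix.eta_fin_two] at this
  exact (this (congrArg Units.val hσ) (congrArg Units.val hτ)).imp
    (fun h => Units.ext h) (fun h => Units.ext h)

theorem sq_eq_one_of_mem_closure {G : Type*} [Group G] {σ τ : G} (hσ : σ ^ 2 = 1) (hτ : τ ^ 2 = 1)
    (h : σ * τ = τ * σ) {x : G} (hx : x ∈ Subgroup.closure {σ, τ}) : x ^ 2 = 1 := by
  have hcomm := Subgroup.isMulCommutative_closure (k := {σ, τ}) (by
    rintro a (rfl | rfl) b (rfl | rfl) <;> simp [h])
  induction hx using Subgroup.closure_induction with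
  | mem x hx =>
    obtain rfl | rfl := hx
    · exact hσ
    · exact hτ
  | one => simp
  | mul x y hx hy ihx ihy =>
    have : Commute x y := congrArg Subtype.val (hcomm.is_comm.comm ⟨x, hx⟩ ⟨y, hy⟩)
    rw [this.mul_pow, ihx, ihy, one_mul]
  | inv x hx ih => rw [inv_pow, ih, inv_one]

/-- Elements of determinants `-1` and `125` whose reductions generate a `2`-group. -/
theorem exists_pair {H : Subgroup (GL (Fin 2) ℤ_[2])} (hdet : H.map GeneralLinearGroup.det = ⊤) :
    ∃ g ∈ H, ∃ h ∈ H, g.val.det = -1 ∧ h.val.det = 125 ∧ red 1 g ^ 2 = 1 ∧ red 1 h ^ 2 = 1 ∧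
      red 1 g * red 1 h = red 1 h * red 1 g := by
  have h2 : ¬ (2 : ℤ_[2]) ∣ 1 := (isUnit_iff_not_dvd 1).1 isUnit_one
  obtain ⟨u, hu⟩ := exists_units_val_eq 5 fun h => h2 (by
    have := dvd_sub h (dvd_mul_right 2 2)
    norm_num at this
    exact this)
  obtain ⟨g, hg, hgdet⟩ := exists_mem_det_eq hdet (-1)
  obtain ⟨h, hh, hhdet⟩ := exists_mem_det_eq hdet u
  -- Cubing removes the 3-part mod 2, keeps -1, and sends 5 to 125 ≡ 5 mod 8.
  have hgdet' : (g ^ 3).val.det = -1 := by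
    have := congrArg (fun u => (u ^ 3).val) hgdet
    simpa [Odd.neg_pow (show Odd 3 by decide)] using this
  have hhdet' : (h ^ 3).val.det = 125 := by
    have := congrArg (fun u => (u ^ 3).val) hhdet
    norm_num [hu] at this
    simpa using this
  have hg2 : red 1 (g ^ 3) ^ 2 = 1 := by rw [map_pow, ← pow_mul]; exact GL_two_pow_six _
  have hh2 : red 1 (h ^ 3) ^ 2 = 1 := by rw [map_pow, ← pow_mul]; exact GL_two_pow_six _
  have hgH := H.pow_mem hg 3
  have hhH := H.pow_mem hh 3
  generalize g ^ 3 = g at *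
  generalize h ^ 3 = h at *
  obtain hc | hc := GL_two_conj_of_sq hg2 hh2
  · exact ⟨g, hgH, h, hhH, hgdet', hhdet', hg2, hh2, hc⟩
  -- If the reductions do not commute, conjugating h by gh makes its reduction equal to that of g
  -- without changing its determinant.
  · have hred : red 1 ((g * h)⁻¹ * h * (g * h)) = red 1 g := by
      have e₁ : (red 1 g)⁻¹ = red 1 g := inv_eq_of_mul_eq_one_right (by rw [← pow_two, hg2])
      have e₂ : (red 1 h)⁻¹ = red 1 h := inv_eq_of_mul_eq_one_right (by rw [← pow_two, hh2])
      rw [← hc]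
      simp only [map_mul, map_inv, _root_.mul_inv_rev, e₁, e₂, mul_assoc]
    have hgh := H.mul_mem hgH hhH
    refine ⟨g, hgH, (g * h)⁻¹ * h * (g * h), H.mul_mem (H.mul_mem (H.inv_mem hgh) hhH) hgh, hgdet',
      ?_, hg2, by rw [hred, hg2], by rw [hred]⟩
    have : GeneralLinearGroup.det ((g * h)⁻¹ * h * (g * h)) = GeneralLinearGroup.det h := by
      simp only [map_mul, map_inv]
      rw [mul_right_comm, inv_mul_cancel, one_mul]
    exact (congrArg Units.val this).trans hhdet'

theorem red_one_upper {x : ℤ_[2]} (hx : 2 ∣ x) : red 1 (upper x) = 1 := by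
  rw [← map_one (red 1), red_eq_iff_dvd]
  intro i k
  fin_cases i <;> fin_cases k <;> simp [hx]

theorem red_one_lower {x : ℤ_[2]} (hx : 2 ∣ x) : red 1 (lower x) = 1 := by
  rw [← map_one (red 1), red_eq_iff_dvd]
  intro i k
  fin_cases i <;> fin_cases k <;> simp [hx]

/-- The elementary factors moving the pair into general position have entries in 2Nℤ: they are N-th
powers, so lie in `H`, are trivial mod 2, and have determinant 1. -/
theorem exists_generators {H : Subgroup (GL (Fin 2) ℤ_[2])} (hH : H.FiniteIndex)
    (hdet : H.map GeneralLinearGroup.det = ⊤) :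
    ∃ g ∈ H, ∃ h ∈ H, g.val.det = -1 ∧ h.val.det = 125 ∧
      (∀ x ∈ Subgroup.closure {g, h}, red 1 x ^ 2 = 1) ∧
      g.val.trace ≠ 0 ∧ h.val.trace ≠ 0 ∧ (g * h).val.trace ≠ 0 ∧
      (g.val * h.val - h.val * g.val).det ≠ 0 := by
  obtain ⟨g₀, hg₀, h₀, hh₀, hgd, hhd, hg2, hh2, hc⟩ := exists_pair hdet
  obtain ⟨N, hN, hpow⟩ := exists_pow_mem hH
  have hN' : (2 * N : ℤ_[2]) ≠ 0 := by exact_mod_cast mul_ne_zero two_ne_zero hN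
  obtain ⟨k, l, m, n, g, h, hg, hh, hgt, hht, hght, hdet⟩ := exists_generic g₀ h₀ hN'
  have hU : ∀ n : ℕ, upper (2 * N * n : ℤ_[2]) ∈ H := fun n => by
    rw [show (2 * N * n : ℤ_[2]) = N * (2 * n) by ring, ← upper_pow]
    exact hpow _
  have hL : ∀ n : ℕ, lower (2 * N * n : ℤ_[2]) ∈ H := fun n => by
    rw [show (2 * N * n : ℤ_[2]) = N * (2 * n) by ring, ← lower_pow]
    exact hpow _
  have hU' : ∀ n : ℕ, red 1 (upper (2 * N * n : ℤ_[2])) = 1 := fun n =>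
    red_one_upper ((dvd_mul_right _ _).mul_right _)
  have hL' : ∀ n : ℕ, red 1 (lower (2 * N * n : ℤ_[2])) = 1 := fun n =>
    red_one_lower ((dvd_mul_right _ _).mul_right _)
  have hgr : red 1 g = red 1 g₀ := by rw [hg, map_mul, map_mul, hU', hL', mul_one, mul_one]
  have hhr : red 1 h = red 1 h₀ := by rw [hh, map_mul, map_mul, hU', hL', mul_one, mul_one]
  refine ⟨g, hg ▸ H.mul_mem (H.mul_mem hg₀ (hL k)) (hU l), h,
    hh ▸ H.mul_mem (H.mul_mem hh₀ (hL m)) (hU n), ?_, ?_, fun x hx => ?_, hgt, hht, hght, hdet⟩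
  · rw [hg]
    simp [Matrix.det_fin_two_of, hgd]
  · rw [hh]
    simp [Matrix.det_fin_two_of, hhd]
  · refine sq_eq_one_of_mem_closure hg2 hh2 hc ?_
    have := Subgroup.mem_map_of_mem (red 1) hx
    rwa [MonoidHom.map_closure, Set.image_pair, hgr, hhr] at this

/-! ### The Frattini argument at finite level and its limit. -/

/-- A subset of `(ℤ/8)ˣ` that is the kernel of a character with values in `{±1}`, prescribed at
`-1` and `5`. -/
def charKer (A B : Bool) (u : (ZMod 8)ˣ) : Bool :=
  if A then B || u.val == 1 || u.val == -1
  else if B then u.val == 1 || u.val == 5 else u.val == 1 || u.val == -5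

theorem charKer_mul (A B : Bool) (u v : (ZMod 8)ˣ) :
    charKer A B (u * v) = (charKer A B u == charKer A B v) := by
  revert A B u v
  decide

theorem charKer_neg_one (A B : Bool) {u : (ZMod 8)ˣ} (hu : u.val = -1) : charKer A B u = A := by
  revert A B u
  decide

theorem charKer_five (A B : Bool) {u : (ZMod 8)ˣ} (hu : u.val = 5) : charKer A B u = B := by
  revert A B u
  decide

/-- In a finite `2`-group generated by `g` and `h`, a subgroup that contains elements with the same
image in `(ℤ/8)ˣ` as `g` and `h`, where these images are `-1` and `5`, is everything. -/
theorem closure_pair_le {G : Type*} [Group G] [Finite G] (D : G →* (ZMod 8)ˣ) {g h : G}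
    (hg : (D g).val = -1) (hh : (D h).val = 5) (hP : IsPGroup 2 (Subgroup.closure {g, h}))
    {K : Subgroup G} (hK : K ≤ Subgroup.closure {g, h}) (hkg : ∃ k ∈ K, D k = D g)
    (hkh : ∃ k ∈ K, D k = D h) : Subgroup.closure {g, h} ≤ K := by
  classical
  set P := Subgroup.closure {g, h}
  by_contra hKP
  have hgP : g ∈ P := Subgroup.subset_closure (by simp)
  have hhP : h ∈ P := Subgroup.subset_closure (by simp)
  obtain ⟨n, hn⟩ := IsPGroup.iff_card.1 hP
  obtain ⟨m, hm⟩ := IsPGroup.iff_card.1 (hP.to_subgroup (K.subgroupOf P))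
  have hlt : m < n := by
    by_contra hmn
    have h1 : Nat.card P ≤ Nat.card (K.subgroupOf P) := by
      rw [hn, hm]
      exact Nat.pow_le_pow_right (by norm_num) (by omega)
    exact hKP (Subgroup.subgroupOf_eq_top.1 (Subgroup.eq_top_of_le_card _ h1))
  obtain ⟨L, hL, hKL⟩ := Sylow.exists_subgroup_card_pow_prime_le (G := P) 2 (m := n - 1)
    (hn ▸ pow_dvd_pow _ (by omega)) (K.subgroupOf P) hm (by omega)
  have hindex : L.index = 2 := by
    have := L.card_mul_index
    rw [hL, hn, show n = n - 1 + 1 by omega, pow_succ] at this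
    simpa using this
  -- L is an index-2 subgroup containing K. Its sign character agrees on g and h with one pulled
  -- back from `(ZMod 8)ˣ`, so L is a preimage under D.
  set W := charKer (decide (⟨g, hgP⟩ ∈ L)) (decide (⟨h, hhP⟩ ∈ L)) with hW
  have hW1 : W 1 = true := by
    have := charKer_mul (decide (⟨g, hgP⟩ ∈ L)) (decide (⟨h, hhP⟩ ∈ L)) 1 1
    simpa [← hW] using this
  have key : ∀ x (hx : x ∈ P), (⟨x, hx⟩ ∈ L ↔ W (D x) = true) := by
    intro x hx
    induction hx using Subgroup.closure_induction with
    | mem x hx =>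
      obtain rfl | rfl := hx
      · rw [hW, charKer_neg_one _ _ hg, decide_eq_true_iff]
      · rw [hW, charKer_five _ _ hh, decide_eq_true_iff]
    | one =>
      rw [map_one, hW1]
      exact iff_of_true L.one_mem rfl
    | mul x y hx hy ihx ihy =>
      rw [map_mul, hW, charKer_mul, ← hW, beq_iff_eq, Bool.eq_iff_iff, ← ihx, ← ihy]
      exact Subgroup.mul_mem_iff_of_index_two hindex (a := ⟨x, hx⟩) (b := ⟨y, hy⟩)
    | inv x hx ih =>
      have h1 : W (D x⁻¹) = W (D x) := by
        have := charKer_mul (decide (⟨g, hgP⟩ ∈ L)) (decide (⟨h, hhP⟩ ∈ L)) (D x⁻¹) (D x)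
        rw [← map_mul, inv_mul_cancel, map_one, ← hW, hW1] at this
        simpa using this.symm
      rw [h1, ← ih]
      exact L.inv_mem_iff (x := ⟨x, hx⟩)
  have hWK : ∀ k ∈ K, W (D k) = true := fun k hk =>
    (key k (hK hk)).1 (hKL (Subgroup.mem_subgroupOf.2 hk))
  obtain ⟨k, hk, hkD⟩ := hkg
  obtain ⟨l, hl, hlD⟩ := hkh
  have hgL := (key g hgP).2 (hkD ▸ hWK k hk)
  have hhL := (key h hhP).2 (hlD ▸ hWK l hl)
  have htop : L = ⊤ := by
    rw [eq_top_iff]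
    rintro ⟨x, hx⟩ -
    have : P ≤ L.map P.subtype := by
      refine (Subgroup.closure_le (L.map P.subtype)).2 ?_
      rintro y (rfl | rfl)
      · exact ⟨_, hgL, rfl⟩
      · exact ⟨_, hhL, rfl⟩
    obtain ⟨y, hy, rfl⟩ := this hx
    exact hy
  rw [htop, Subgroup.index_top] at hindex
  omega

/-- Squaring 1 + 2^(n+1) E gains a digit; hence the finite images of `closure {g, h}` are 2-groups.
-/
theorem red_pow_two_pow {x : GL (Fin 2) ℤ_[2]} (hx : red 1 x = 1) (n : ℕ) :
    red (n + 1) (x ^ 2 ^ n) = 1 := by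
  induction n with
  | zero => simpa using hx
  | succ n ih =>
    rw [← map_one (red _), red_eq_iff] at ih ⊢
    obtain ⟨E, hE⟩ := ih
    refine ⟨E + (2 : ℤ_[2]) ^ n • (E * E), ?_⟩
    rw [pow_succ 2 n, pow_mul, Units.val_pow_eq_pow_val, hE, Units.val_one, pow_two]
    simp only [add_mul, mul_add, mul_one, one_mul, smul_mul_assoc, mul_smul_comm]
    module

theorem dvd_trace_of_red_sq {x : GL (Fin 2) ℤ_[2]} (hx : red 1 x ^ 2 = 1) :
    (2 : ℤ_[2]) ∣ x.val.trace := by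
  have key : ∀ a b c d : ZMod (2 ^ 1), !![a, b; c, d] ^ 2 = 1 → a + d = 0 := by decide
  have h := key (red 1 x 0 0) (red 1 x 0 1) (red 1 x 1 0) (red 1 x 1 1) (by
    rw [← Matrix.eta_fin_two]
    exact congrArg Units.val hx)
  have := toZModPow_eq_iff 1 (x.val.trace) 0
  suffices (2 : ℤ_[2]) ^ 1 ∣ x.val.trace - 0 by simpa using this
  refine this.1 ?_
  rw [Matrix.trace_fin_two, map_add, map_zero]
  exact h

instance (n : ℕ) : Finite (ZMod (2 ^ n)) :=
  have : NeZero (2 ^ n) := ⟨by positivity⟩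
  inferInstance

/-- The determinant modulo `8` on `GL₂(ℤ/2ⁿ⁺³)`. -/
noncomputable def detModEight (n : ℕ) : GL (Fin 2) (ZMod (2 ^ (n + 3))) →* (ZMod 8)ˣ :=
  (Units.map (ZMod.castHom (Dvd.intro_left (2 ^ n) (by ring)) (ZMod 8) :
    ZMod (2 ^ (n + 3)) →+* ZMod 8).toMonoidHom).comp GeneralLinearGroup.det

theorem detModEight_red (n : ℕ) (x : GL (Fin 2) ℤ_[2]) : (detModEight n (red (n + 3) x)).val =
    ZMod.castHom (Dvd.intro_left (2 ^ n) (by ring)) (ZMod 8)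
      (PadicInt.toZModPow (n + 3) x.val.det) := by
  have : (GeneralLinearGroup.det (red (n + 3) x)).val = PadicInt.toZModPow (n + 3) x.val.det := by
    rw [red, GeneralLinearGroup.map_det]
    rfl
  rw [← this]
  rfl

theorem detModEight_red_eq (n : ℕ) {x y : GL (Fin 2) ℤ_[2]}
    (h : GeneralLinearGroup.det x = GeneralLinearGroup.det y) :
    detModEight n (red (n + 3) x) = detModEight n (red (n + 3) y) := by
  apply Units.ext
  rw [detModEight_red, detModEight_red]
  exact congrArg _ (congrArg _ (congrArg Units.val h))

theorem isClosed_map_det {M : Subgroup (GL (Fin 2) ℤ_[2])}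
    (hM : IsClosed (M : Set (GL (Fin 2) ℤ_[2]))) :
    IsClosed (M.map GeneralLinearGroup.det : Set ℤ_[2]ˣ) :=
  (hM.isCompact.image GeneralLinearGroup.continuous_det).isClosed

theorem map_det_topologicalClosure {g h : GL (Fin 2) ℤ_[2]} (hg : g.val.det = -1)
    (hh : h.val.det = 125) :
    (Subgroup.closure {g, h}).topologicalClosure.map GeneralLinearGroup.det = ⊤ := by
  have hle := (Subgroup.closure {g, h}).le_topologicalClosure
  -- 125 = 1 + 4 · 31, the form required by `units_eq_top`.
  have hunit : IsUnit (31 : ℤ_[2]) := by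
    have := isUnit_add_of_dvd isUnit_one (dvd_mul_right (2 : ℤ_[2]) 15)
    norm_num at this
    exact this
  refine units_eq_top (isClosed_map_det (Subgroup.isClosed_topologicalClosure _))
    (u := GeneralLinearGroup.det h) ⟨g, hle (Subgroup.subset_closure (by simp)), ?_⟩
    ⟨h, hle (Subgroup.subset_closure (by simp)), rfl⟩ hunit (hh.trans (by norm_num))
  exact Units.ext hg

theorem topologicalClosure_le_of_map_det {g h : GL (Fin 2) ℤ_[2]} (hg : g.val.det = -1)
    (hh : h.val.det = 125) (hP : ∀ x ∈ Subgroup.closure {g, h}, red 1 x ^ 2 = 1)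
    {K : Subgroup (GL (Fin 2) ℤ_[2])} (hKclosed : IsClosed (K : Set (GL (Fin 2) ℤ_[2])))
    (hK : K ≤ (Subgroup.closure {g, h}).topologicalClosure)
    (hKdet : K.map GeneralLinearGroup.det = ⊤) :
    (Subgroup.closure {g, h}).topologicalClosure ≤ K := by
  refine Subgroup.topologicalClosure_minimal _ (fun x hx => ?_) hKclosed
  refine mem_of_forall_red hKclosed fun n => ?_
  have hmap : (Subgroup.closure {g, h}).map (red (n + 3)) =
      Subgroup.closure {red (n + 3) g, red (n + 3) h} := by
    rw [MonoidHom.map_closure, Set.image_pair]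
  have hle : Subgroup.closure {red (n + 3) g, red (n + 3) h} ≤ K.map (red (n + 3)) := by
    obtain ⟨k, hk, hkg⟩ := exists_mem_det_eq hKdet (GeneralLinearGroup.det g)
    obtain ⟨l, hl, hlh⟩ := exists_mem_det_eq hKdet (GeneralLinearGroup.det h)
    refine closure_pair_le (detModEight n) ?_ ?_ ?_ ?_
      ⟨_, Subgroup.mem_map_of_mem _ hk, detModEight_red_eq n hkg⟩
      ⟨_, Subgroup.mem_map_of_mem _ hl, detModEight_red_eq n hlh⟩
    · rw [detModEight_red, hg, map_neg, map_neg, map_one, map_one]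
    · rw [detModEight_red, hh, map_ofNat, map_ofNat]
      decide
    · rw [← hmap]
      rintro ⟨-, y, hy, rfl⟩
      -- One squaring reaches 1 mod 2, and n + 2 more reach 1 mod 2^(n+3).
      refine ⟨n + 3, Subtype.ext ?_⟩
      have := red_pow_two_pow (x := y ^ 2) (by rw [map_pow]; exact hP y hy) (n + 2)
      rw [← pow_mul, ← pow_succ'] at this
      simpa using this
    · rw [← hmap]
      rintro - ⟨y, hy, rfl⟩
      obtain ⟨z, hz, hzy⟩ := exists_red_eq_of_mem_closure (hK hy) (n + 3)
      exact ⟨z, hz, hzy⟩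
  have hxK : red (n + 3) x ∈ K.map (red (n + 3)) :=
    hle (hmap ▸ Subgroup.mem_map_of_mem _ hx)
  obtain ⟨y, hy, hyx⟩ := hxK
  exact ⟨y, hy, red_eq_of_le (by omega) hyx⟩

end TwoAdic

theorem theorem2 (H : Subgroup (Matrix.GeneralLinearGroup (Fin 2) ℤ_[2]))
    (hfin : H.FiniteIndex) (hdet : H.map Matrix.GeneralLinearGroup.det = ⊤) :
    ∃ M : Subgroup (Matrix.GeneralLinearGroup (Fin 2) ℤ_[2]),
      IsMinimalSubgroup M ∧ M ≤ H ∧ (M.subgroupOf H).FiniteIndex := by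
  obtain ⟨g, hg, h, hh, hgd, hhd, hP, hgt, hht, hght, hcomm⟩ :=
    TwoAdic.exists_generators hfin hdet
  set M := (Subgroup.closure {g, h}).topologicalClosure with hM
  have hMclosed : IsClosed (M : Set (GL (Fin 2) ℤ_[2])) := Subgroup.isClosed_topologicalClosure _
  have hgP : g ∈ Subgroup.closure {g, h} := Subgroup.subset_closure (by simp)
  have hhP : h ∈ Subgroup.closure {g, h} := Subgroup.subset_closure (by simp)
  have hle := (Subgroup.closure {g, h}).le_topologicalClosure
  have hMdet := TwoAdic.map_det_topologicalClosure hgd hhd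
  obtain ⟨j, hj, hred⟩ := TwoAdic.exists_red_eq_one_mem_withScalars hMclosed (hle hgP) (hle hhP)
    (TwoAdic.dvd_trace_of_red_sq (hP _ hgP)) (TwoAdic.dvd_trace_of_red_sq (hP _ hhP))
    (TwoAdic.dvd_trace_of_red_sq (hP _ (mul_mem hgP hhP))) hgt hht hght hcomm
  obtain ⟨hU, hL⟩ := TwoAdic.exists_elementary_mem hj hred
  have hMfin : M.FiniteIndex :=
    TwoAdic.finiteIndex_of_elementary (mul_ne_zero two_ne_zero hj) hU hL hMdet
  refine ⟨M, ⟨hMfin, hMdet, fun K hK hKM hKdet => ?_⟩, ?_, inferInstance⟩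
  · exact hKM.not_ge
      (TwoAdic.topologicalClosure_le_of_map_det hgd hhd hP hK hKM.le hKdet)
  · refine Subgroup.topologicalClosure_minimal _ ?_ (TwoAdic.isClosed_of_finiteIndex hfin)
    rw [Subgroup.closure_le]
    rintro x (rfl | rfl)
    · exact hg
    · exact hh
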